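/- Let $n\ge 1$. Each of $n$ traders $k\in\{1,\dots,n\}$, trader $k$ initially owning good $k$, ranks all $n$ goods in a preference list $p_k=p_{k1}p_{k2}\dots p_{kn}$, a permutation of $\{1,\dots,n\}$ ($p_{k1}$ is the most preferred good). An allocation is a permutation $g_1\dots g_n$ of the goods, trader $k$ getting $g_k$; the rank of $g_k$ is the $r$ with $g_k=p_{kr}$. The allocation is *stable* if, for every nonempty coalition $C$ of traders and every allocation $h$ of the goods of $C$ to the members of $C$ such that every $k\in C$ likes $h_k$ at least as much as $g_k$, one has $h_k=g_k$ for all $k\in C$. For every choice of preference lists there is exactly one stable allocation; let $r_1,\dots,r_n$ be the ranks that the traders get in it. In *uniform hashing*, trader $1,2,\dots,n$ in turn gets the first good on his list that no earlier trader has taken; let $\rho_1,\dots,\rho_n$ be the resulting ranks. Suppose that $p_1,\dots,p_n$ are independent and uniformly random, and put $q_{kj}=\Pr(\rho_k>j)$. Then: 1. $\rho_n$ is uniformly distributed on $\{1,\dots,n\}$. 2. $\Pr\bigl(r_k\ge n/2\text{ for some }k\bigr)\ge \tfrac12$. 3. With $m=\lfloor n/2\rfloor$, $$\Pr\bigl(\max(r_1,\dots,r_n)\le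 n/2\bigr)=\prod_{k=1}^n(1-q_{km}),\qquad\text{where } q_{kj}=\binom{k-1}{j}\Big/\binom nj\quad(1\le k\le n,\ 0\le j\le n).$$ 4. As $n\to\infty$ this probability tends to the convergent infinite product $$\prod_{j\ge1}\bigl(1-2^{-j}\bigr)\approx 0.288788,$$ where the numerical value is correct to within $5\cdot10^{-7}$. -/

import Mathlib

open MeasureTheory ProbabilityTheory Filter Topology

/-- A sequence of preference lists for `n` traders and `n` goods (both indexed by `Fin n`):
`p k i` is the good standing at (zero-based) position `i` in the list of trader `k`. -/
abbrev Preferences (n : ℕ) : Type := Fin n → Equiv.Perm (Fin n)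

/-- The (one-based) rank of the good `i` in the preference list of trader `k`. -/
def goodRank {n : ℕ} (p : Preferences n) (k i : Fin n) : ℕ := ((p k).symm i : ℕ) + 1

/-- Trader `k` likes the good `i` at least as much as the good `j`:
either `i = j` or `i` precedes `j` in the list of `k`. -/
def WeaklyPrefers {n : ℕ} (p : Preferences n) (k i j : Fin n) : Prop :=
  goodRank p k i ≤ goodRank p k j

/-- Stability of an allocation `g` (trader `k` gets good `g k`; trader `k` initially owns good
`k`): whenever `h` allocates the goods of a nonempty coalition `C` to the members of `C` in such
a way that no member of `C` is worse off than under `g`, then `h` agrees with `g` on `C`. -/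
def IsStableAllocation {n : ℕ} (p : Preferences n) (g : Equiv.Perm (Fin n)) : Prop :=
  ∀ C : Set (Fin n), C.Nonempty → ∀ h : Equiv.Perm C,
    (∀ k : C, WeaklyPrefers p k (h k) (g k)) → ∀ k : C, (h k : Fin n) = g k

/-- The stable allocation for the preferences `p`. -/
noncomputable def stableAllocation {n : ℕ} (p : Preferences n) : Equiv.Perm (Fin n) :=
  Classical.epsilon (IsStableAllocation p)

/-- The rank, in the list of trader `k`, of the good that `k` gets in the stable allocation. -/
noncomputable def stableRank {n : ℕ} (p : Preferences n) (k : Fin n) : ℕ :=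
  goodRank p k (stableAllocation p k)

/-- The goods taken by the traders before `k` do not exhaust the list of trader `k`. -/
theorem exists_free_position {n : ℕ} (k : Fin n) (q : Equiv.Perm (Fin n))
    (f : {j : Fin n // j < k} → Fin n) :
    (Finset.univ.filter (fun i : Fin n => ∀ j : {j : Fin n // j < k}, f j ≠ q i)).Nonempty := by
  classical
  by_contra hne
  rw [Finset.not_nonempty_iff_eq_empty, Finset.filter_eq_empty_iff] at hne
  have hsur : Function.Surjective f := by
    intro y
    have hy := hne (Finset.mem_univ (q.symm y))
    push Not at hy
    obtain ⟨j, e⟩ := hy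
    exact ⟨j, by simpa using e⟩
  have hcard := Fintype.card_le_of_surjective _ hsur
  have hlt : Fintype.card {j : Fin n // j < k} < Fintype.card (Fin n) :=
    Fintype.card_subtype_lt (x := k) (lt_irrefl k)
  omega

/-- Uniform hashing (first come, first served): the zero-based position, in the list of trader
`k`, of the first good that was not taken by any of the traders before `k`. -/
def hashPosition {n : ℕ} (p : Preferences n) (k : Fin n) : Fin n :=
  (Finset.univ.filter (fun i : Fin n =>
      ∀ j : {j : Fin n // j < k}, p j.1 (hashPosition p j.1) ≠ p k i)).min'
    (exists_free_position k (p k) (fun j => p j.1 (hashPosition p j.1)))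
termination_by k

/-- The one-based rank of the good that trader `k` gets in uniform hashing. -/
def hashRank {n : ℕ} (p : Preferences n) (k : Fin n) : ℕ := (hashPosition p k : ℕ) + 1

instance permFinMeasurableSpace (n : ℕ) : MeasurableSpace (Equiv.Perm (Fin n)) := ⊤

instance permFinDiscrete (n : ℕ) : DiscreteMeasurableSpace (Equiv.Perm (Fin n)) :=
  ⟨fun _ => trivial⟩

/-- The law of independent, uniformly random preference lists: the product of `n` copies of
the uniform distribution on all permutations. -/
noncomputable def preferenceMeasure (n : ℕ) : Measure (Preferences n) :=
  Measure.pi (fun _ : Fin n => uniformOn (Set.univ : Set (Equiv.Perm (Fin n))))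

instance preferenceMeasure_isProbabilityMeasure (n : ℕ) :
    IsProbabilityMeasure (preferenceMeasure n) := by
  have : IsProbabilityMeasure (uniformOn (Set.univ : Set (Equiv.Perm (Fin n)))) :=
    isProbabilityMeasure_uniformOn Set.finite_univ Set.univ_nonempty
  unfold preferenceMeasure
  infer_instance

/-- The probability that the rank of the good of trader `k` in uniform hashing exceeds `j`. -/
noncomputable def hashTail (n : ℕ) (k : Fin n) (j : ℕ) : ℝ :=
  (preferenceMeasure n).real {p | j < hashRank p k}

/-! The stable allocation comes from trading cycles. In a market `U` every trader points to his
favourite good of `U`; the traders on cycles of this map must get what they point to, and what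
remains is stability of the smaller market (`isStableOn_iff_of_bijOn`). Existence and uniqueness
follow by induction on `U`.

The law of the largest rank comes from removing one trader at a time. On the cycle traders the
pointing map is a permutation, and interchanging two of their goods in all their lists multiplies it
by a transposition while preserving both the set of cycle traders and the ranks obtained
(`retarget`). So it has one fixed point on average, even when only preferences with all ranks at
most `m` are counted (`sum_card_favoriteMap_eq_self`). A fixed point `x` can be removed alone, and
the market left does not involve the list of `x`. Summing over `x`, each removal contributes the
probability that the first `m` goods of a random list meet `U`, which is `1 - (n - |U|).choose m /
n.choose m` (`card_stableRanksLE`).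

In hashing, the zero-based trader `k` faces `k` taken goods that are independent of his own list,
which gives the same binomial quotients (`hashTail_eq`). The bound `1/2` uses only the last factor
of the product; the limit is dominated convergence for products. -/

/-! ### Stability in submarkets and removal of trading cycles. -/

/-- The function `g` permutes `U`, and no coalition inside `U` can reallocate its own goods so that
none of its members loses, except by following `g`. -/
def IsStableOn {n : ℕ} (p : Preferences n) (U : Set (Fin n)) (g : Fin n → Fin n) : Prop :=
  Set.BijOn g U U ∧ ∀ C ⊆ U, C.Nonempty → ∀ h : Fin n → Fin n, Set.BijOn h C C →
    (∀ k ∈ C, WeaklyPrefers p k (h k) (g k)) → Set.EqOn h g C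

theorem isStableAllocation_iff_isStableOn_univ {n : ℕ} (p : Preferences n)
    (g : Equiv.Perm (Fin n)) : IsStableAllocation p g ↔ IsStableOn p Set.univ g := by
  classical
  constructor
  · intro hg
    refine ⟨Set.bijOn_univ.2 g.bijective, fun C _ hC h hh hp k hk => ?_⟩
    exact hg C hC (hh.equiv h) (fun k => hp k k.2) ⟨k, hk⟩
  · rintro ⟨-, hg⟩ C hC h hp k
    let h' : Fin n → Fin n := fun k => if hk : k ∈ C then h ⟨k, hk⟩ else k
    have hval : ∀ k : C, h' k = h k := fun k => by simp [h']
    have hbij : Set.BijOn h' C C := by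
      refine ⟨fun k hk => ?_, fun a ha b hb hab => ?_, fun b hb => ?_⟩
      · rw [hval ⟨k, hk⟩]; exact (h ⟨k, hk⟩).2
      · rw [hval ⟨a, ha⟩, hval ⟨b, hb⟩] at hab
        simpa using h.injective (Subtype.ext hab)
      · refine ⟨h.symm ⟨b, hb⟩, (h.symm ⟨b, hb⟩).2, ?_⟩
        rw [hval]; simp
    rw [← hval k]
    refine hg C (Set.subset_univ _) hC h' hbij (fun k hk => ?_) k.2
    rw [hval ⟨k, hk⟩]
    exact hp ⟨k, hk⟩

/-- The element of `U` standing first in the list `q` (and `d` if `U` is empty). -/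
noncomputable def favorite {n : ℕ} (q : Equiv.Perm (Fin n)) (U : Set (Fin n)) (d : Fin n) :
    Fin n :=
  open scoped Classical in
  if h : U.Nonempty then (Set.exists_min_image U q.symm U.toFinite h).choose else d

section favorite

variable {n : ℕ} {q : Equiv.Perm (Fin n)} {U : Set (Fin n)} (d : Fin n)

theorem favorite_mem (hU : U.Nonempty) : favorite q U d ∈ U := by
  rw [favorite, dif_pos hU]
  exact (Set.exists_min_image U q.symm U.toFinite hU).choose_spec.1

theorem symm_favorite_le {y : Fin n} (hy : y ∈ U) : q.symm (favorite q U d) ≤ q.symm y := by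
  have hU : U.Nonempty := ⟨y, hy⟩
  rw [favorite, dif_pos hU]
  exact (Set.exists_min_image U q.symm U.toFinite hU).choose_spec.2 y hy

theorem eq_favorite {y : Fin n} (hy : y ∈ U) (h : ∀ z ∈ U, q.symm y ≤ q.symm z) :
    y = favorite q U d :=
  q.symm.injective (le_antisymm (h _ (favorite_mem d ⟨y, hy⟩)) (symm_favorite_le d hy))

theorem favorite_trans_swap {a b : Fin n} (ha : a ∈ U) (hb : b ∈ U) :
    favorite (q.trans (Equiv.swap a b)) U d = Equiv.swap a b (favorite q U d) := by
  have hmem : ∀ z ∈ U, Equiv.swap a b z ∈ U := by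
    intro z hz
    rw [Equiv.swap_apply_def]
    split_ifs <;> assumption
  refine (eq_favorite d (hmem _ (favorite_mem d ⟨a, ha⟩)) fun z hz => ?_).symm
  simpa using symm_favorite_le d (hmem z hz)

end favorite

/-- Trader `k` points to his favourite good in `U`. -/
noncomputable def favoriteMap {n : ℕ} (p : Preferences n) (U : Set (Fin n)) (k : Fin n) : Fin n :=
  favorite (p k) U k

section stability

variable {n : ℕ} {p p' : Preferences n} {U X : Set (Fin n)} {g g' : Fin n → Fin n}

theorem weaklyPrefers_iff {k i j : Fin n} :
    WeaklyPrefers p k i j ↔ (p k).symm i ≤ (p k).symm j := by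
  simp [WeaklyPrefers, goodRank]

theorem eq_favoriteMap_of_weaklyPrefers {k y : Fin n} (hy : y ∈ U)
    (h : WeaklyPrefers p k y (favoriteMap p U k)) : y = favoriteMap p U k :=
  eq_favorite k hy fun _ hz => (weaklyPrefers_iff.1 h).trans (symm_favorite_le k hz)

theorem weaklyPrefers_favoriteMap {k y : Fin n} (hy : y ∈ U) :
    WeaklyPrefers p k (favoriteMap p U k) y :=
  weaklyPrefers_iff.2 (symm_favorite_le k hy)

theorem IsStableOn.congr (h : IsStableOn p U g) (hp : ∀ k ∈ U, p k = p' k)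
    (hg : Set.EqOn g g' U) : IsStableOn p' U g' := by
  refine ⟨h.1.congr hg, fun C hC hne f hf hpref k hk => ?_⟩
  rw [← hg (hC hk)]
  refine h.2 C hC hne f hf (fun k hk => ?_) hk
  have := hpref k hk
  rw [weaklyPrefers_iff, ← hp k (hC hk), ← hg (hC hk)] at this
  exact weaklyPrefers_iff.2 this

/-- Trading cycles in which everybody gets his favourite good can be removed. -/
theorem isStableOn_iff_of_bijOn (hXU : X ⊆ U) (hX : Set.BijOn (favoriteMap p U) X X) :
    IsStableOn p U g ↔ Set.EqOn g (favoriteMap p U) X ∧ IsStableOn p (U \ X) g := by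
  constructor
  · rintro ⟨hg, hs⟩
    have heq : Set.EqOn g (favoriteMap p U) X := by
      rcases X.eq_empty_or_nonempty with rfl | hne
      · exact Set.eqOn_empty _ _
      -- The coalition `X` can give each member his favourite good, so stability forces `g` to do
      -- so.
      · exact (hs X hXU hne _ hX fun k hk =>
          weaklyPrefers_favoriteMap (hg.mapsTo (hXU hk))).symm
    refine ⟨heq, ?_, fun C hC => hs C (hC.trans Set.sdiff_subset)⟩
    have hgX : Set.BijOn g X X := hX.congr heq.symm
    refine ⟨fun k hk => ⟨hg.mapsTo hk.1, fun hgk => hk.2 ?_⟩,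
      hg.injOn.mono Set.sdiff_subset, fun y hy => ?_⟩
    · obtain ⟨x, hx, hxk⟩ := hgX.surjOn hgk
      exact hg.injOn (hXU hx) hk.1 hxk ▸ hx
    · obtain ⟨x, hx, rfl⟩ := hg.surjOn hy.1
      exact ⟨x, ⟨hx, fun hxX => hy.2 (hgX.mapsTo hxX)⟩, rfl⟩
  · rintro ⟨heq, hg, hs⟩
    have hgX : Set.BijOn g X X := hX.congr heq.symm
    have hgU : Set.BijOn g U U := by
      have := hgX.union hg ((Set.injOn_union Set.disjoint_sdiff_right).2
        ⟨hgX.injOn, hg.injOn, fun a ha b hb hab =>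
          (hg.mapsTo hb).2 (hab ▸ hgX.mapsTo ha)⟩)
      rwa [Set.union_sdiff_cancel hXU] at this
    refine ⟨hgU, fun C hC hne h hh hpref => ?_⟩
    -- Members of `C ∩ X` already have their favourite under `g`, so `h` cannot move them; by
    -- finiteness `h` then permutes `C ∩ X` and `C \ X` separately.
    have h1 : Set.EqOn h g (C ∩ X) := by
      rintro k ⟨hkC, hkX⟩
      have := hpref k hkC
      rw [heq hkX] at this ⊢
      exact eq_favoriteMap_of_weaklyPrefers (hC (hh.mapsTo hkC)) this
    have hmaps : Set.MapsTo h (C ∩ X) (C ∩ X) := fun k hk =>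
      ⟨hh.mapsTo hk.1, h1 hk ▸ hgX.mapsTo hk.2⟩
    have hsurj : Set.SurjOn h (C ∩ X) (C ∩ X) :=
      ((Set.toFinite (C ∩ X)).injOn_iff_bijOn_of_mapsTo hmaps).1
        (hh.injOn.mono Set.inter_subset_left) |>.surjOn
    have hbij : Set.BijOn h (C \ X) (C \ X) := by
      refine ⟨fun k hk => ⟨hh.mapsTo hk.1, fun hhk => hk.2 ?_⟩,
        hh.injOn.mono Set.sdiff_subset, fun y hy => ?_⟩
      · obtain ⟨x, hx, hxk⟩ := hsurj ⟨hh.mapsTo hk.1, hhk⟩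
        exact hh.injOn hx.1 hk.1 hxk ▸ hx.2
      · obtain ⟨x, hx, rfl⟩ := hh.surjOn hy.1
        exact ⟨x, ⟨hx, fun hxX => hy.2 (hmaps ⟨hx, hxX⟩).2⟩, rfl⟩
    intro k hk
    by_cases hkX : k ∈ X
    · exact h1 ⟨hk, hkX⟩
    · exact hs (C \ X) (Set.sdiff_subset_sdiff_left hC) ⟨k, hk, hkX⟩ h hbij
        (fun k hk => hpref k hk.1) ⟨hk, hkX⟩

end stability

/-! ### Periodic points of self-maps of finite sets. -/

section periodic

open Function

variable {α : Type*} {f f' : α → α}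

theorem exists_iterate_mem_periodicPts [Finite α] (f : α → α) (x : α) :
    ∃ m, f^[m] x ∈ periodicPts f := by
  obtain ⟨a, b, hne, heq⟩ := Finite.exists_ne_map_eq_of_infinite fun m => f^[m] x
  wlog hab : a < b generalizing a b
  · exact this b a hne.symm heq.symm (by omega)
  refine ⟨a, mk_mem_periodicPts (Nat.sub_pos_of_lt hab) ?_⟩
  rw [IsPeriodicPt, IsFixedPt, ← iterate_add_apply, Nat.sub_add_cancel hab.le]
  exact heq.symm

theorem subset_periodicPts_of_bijOn {Z : Set α} [Finite α] (h : Set.BijOn f Z Z) :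
    Z ⊆ periodicPts f := by
  intro z hz
  have hinj := h.mapsTo.restrict_inj.2 h.injOn
  obtain ⟨m, hm, hper⟩ := hinj.mem_periodicPts ⟨z, hz⟩
  refine mk_mem_periodicPts hm ?_
  have := congrArg Subtype.val (show (h.mapsTo.restrict f Z Z)^[m] ⟨z, hz⟩ = ⟨z, hz⟩ from hper)
  rwa [h.mapsTo.iterate_restrict] at this

/-- Rerouting a map along its periodic points does not change the set of periodic points. -/
theorem periodicPts_eq_of_bijOn [Finite α] (h : Set.BijOn f' (periodicPts f) (periodicPts f))
    (heq : ∀ x ∉ periodicPts f, f' x = f x) : periodicPts f' = periodicPts f := by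
  refine Set.Subset.antisymm (fun y hy => ?_) (subset_periodicPts_of_bijOn h)
  -- An `f'`-orbit avoiding these points would be an `f`-orbit, and every `f`-orbit reaches them.
  -- Once there, `f'` never leaves, so a periodic `y` lies there too.
  have hex : ∃ m, f'^[m] y ∈ periodicPts f := by
    by_contra! hno
    obtain ⟨m, hm⟩ := exists_iterate_mem_periodicPts f y
    have hit : ∀ m, f'^[m] y = f^[m] y := by
      intro m
      induction m with
      | zero => rfl
      | succ m ih => rw [iterate_succ_apply', iterate_succ_apply', heq _ (hno m), ih]
    exact hno m (hit m ▸ hm)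
  obtain ⟨m, hm⟩ := hex
  obtain ⟨N, hN, hper⟩ := hy
  have hback : f'^[m * N - m] (f'^[m] y) = y := by
    rw [← iterate_add_apply, Nat.sub_add_cancel (Nat.le_mul_of_pos_right m hN)]
    exact hper.const_mul m
  rw [← hback]
  exact h.mapsTo.iterate _ hm

end periodic

/-! ### Existence and uniqueness of the stable allocation. -/

section existence

variable {n : ℕ} {p p' : Preferences n} {U : Set (Fin n)}

/-- The traders that belong to the trading cycles of `favoriteMap p U`. -/
def cycleTraders {n : ℕ} (p : Preferences n) (U : Set (Fin n)) : Set (Fin n) :=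
  Function.periodicPts (favoriteMap p U)

theorem bijOn_cycleTraders (p : Preferences n) (U : Set (Fin n)) :
    Set.BijOn (favoriteMap p U) (cycleTraders p U) (cycleTraders p U) :=
  Function.bijOn_periodicPts _

/-- Traders outside `U` also point into `U`, but nobody points back at them, so they lie on no
cycle. -/
theorem cycleTraders_subset (p : Preferences n) (hU : U.Nonempty) : cycleTraders p U ⊆ U := by
  intro x hx
  obtain ⟨y, -, rfl⟩ := (bijOn_cycleTraders p U).surjOn hx
  exact favorite_mem y hU

theorem cycleTraders_nonempty (p : Preferences n) (hU : U.Nonempty) :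
    (cycleTraders p U).Nonempty :=
  (exists_iterate_mem_periodicPts (favoriteMap p U) hU.some).elim fun _ hm => ⟨_, hm⟩

theorem cycleTraders_diff_ssubset (p : Preferences n) (hU : U.Nonempty) :
    U \ cycleTraders p U ⊂ U := by
  obtain ⟨x, hx⟩ := cycleTraders_nonempty p hU
  exact ⟨Set.sdiff_subset, fun h => (h (cycleTraders_subset p hU hx)).2 hx⟩

theorem exists_isStableOn (p : Preferences n) (U : Set (Fin n)) : ∃ g, IsStableOn p U g := by
  classical
  induction U using WellFoundedLT.induction with
  | ind U ih =>
    rcases U.eq_empty_or_nonempty with rfl | hU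
    · exact ⟨id, Set.bijOn_id _, fun C hC hne => absurd (hne.mono hC) Set.not_nonempty_empty⟩
    · obtain ⟨g, hg⟩ := ih _ (cycleTraders_diff_ssubset p hU)
      refine ⟨(cycleTraders p U).piecewise (favoriteMap p U) g,
        (isStableOn_iff_of_bijOn (cycleTraders_subset p hU) (bijOn_cycleTraders p U)).2
          ⟨Set.piecewise_eqOn _ _ _, hg.congr (fun _ _ => rfl) fun k hk => ?_⟩⟩
      exact (Set.piecewise_eq_of_notMem _ _ _ hk.2).symm

theorem IsStableOn.eqOn {g g' : Fin n → Fin n} (hg : IsStableOn p U g)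
    (hg' : IsStableOn p U g') : Set.EqOn g g' U := by
  induction U using WellFoundedLT.induction with
  | ind U ih =>
    rcases U.eq_empty_or_nonempty with rfl | hU
    · exact Set.eqOn_empty _ _
    · have hsub := cycleTraders_subset p hU
      have hbij := bijOn_cycleTraders p U
      obtain ⟨h1, h2⟩ := (isStableOn_iff_of_bijOn hsub hbij).1 hg
      obtain ⟨h1', h2'⟩ := (isStableOn_iff_of_bijOn hsub hbij).1 hg'
      intro k hk
      by_cases hkX : k ∈ cycleTraders p U
      · rw [h1 hkX, h1' hkX]
      · exact ih _ (cycleTraders_diff_ssubset p hU) h2 h2' ⟨hk, hkX⟩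

theorem existsUnique_isStableAllocation (p : Preferences n) :
    ∃! g : Equiv.Perm (Fin n), IsStableAllocation p g := by
  obtain ⟨g, hg⟩ := exists_isStableOn p Set.univ
  refine ⟨Equiv.ofBijective g (Set.bijOn_univ.1 hg.1),
    (isStableAllocation_iff_isStableOn_univ _ _).2 hg, fun g' hg' => ?_⟩
  exact Equiv.ext fun k =>
    ((isStableAllocation_iff_isStableOn_univ _ _).1 hg').eqOn hg (Set.mem_univ k)

theorem isStableAllocation_stableAllocation (p : Preferences n) :
    IsStableAllocation p (stableAllocation p) :=
  Classical.epsilon_spec (existsUnique_isStableAllocation p).exists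

/-- In the market of the traders in `U`, the stable allocation gives nobody a rank above `m`. -/
def StableRanksLE (p : Preferences n) (U : Set (Fin n)) (m : ℕ) : Prop :=
  ∃ g, IsStableOn p U g ∧ ∀ k ∈ U, goodRank p k (g k) ≤ m

theorem stableRanksLE_univ_iff {m : ℕ} :
    StableRanksLE p Set.univ m ↔ ∀ k, stableRank p k ≤ m := by
  have hs := (isStableAllocation_iff_isStableOn_univ _ _).1 (isStableAllocation_stableAllocation p)
  constructor
  · rintro ⟨g, hg, hm⟩ k
    rw [stableRank, hs.eqOn hg (Set.mem_univ k)]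
    exact hm k (Set.mem_univ k)
  · exact fun h => ⟨_, hs, fun k _ => h k⟩

theorem stableRanksLE_empty (p : Preferences n) (m : ℕ) : StableRanksLE p ∅ m := by
  obtain ⟨g, hg⟩ := exists_isStableOn p ∅
  exact ⟨g, hg, fun k hk => hk.elim⟩

theorem StableRanksLE.congr {m : ℕ} (h : StableRanksLE p U m) (hp : ∀ k ∈ U, p k = p' k) :
    StableRanksLE p' U m := by
  obtain ⟨g, hg, hm⟩ := h
  refine ⟨g, hg.congr hp fun _ _ => rfl, fun k hk => ?_⟩
  rw [goodRank, ← hp k hk]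
  exact hm k hk

theorem stableRanksLE_congr {m : ℕ} (hp : ∀ k ∈ U, p k = p' k) :
    StableRanksLE p U m ↔ StableRanksLE p' U m :=
  ⟨fun h => h.congr hp, fun h => h.congr fun k hk => (hp k hk).symm⟩

theorem stableRanksLE_iff_of_bijOn {X : Set (Fin n)} {m : ℕ} (hXU : X ⊆ U)
    (hX : Set.BijOn (favoriteMap p U) X X) :
    StableRanksLE p U m ↔
      (∀ k ∈ X, goodRank p k (favoriteMap p U k) ≤ m) ∧ StableRanksLE p (U \ X) m := by
  classical
  constructor
  · rintro ⟨g, hg, hm⟩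
    obtain ⟨h1, h2⟩ := (isStableOn_iff_of_bijOn hXU hX).1 hg
    exact ⟨fun k hk => h1 hk ▸ hm k (hXU hk), g, h2, fun k hk => hm k hk.1⟩
  · rintro ⟨h1, g, hg, hm⟩
    refine ⟨X.piecewise (favoriteMap p U) g, (isStableOn_iff_of_bijOn hXU hX).2
      ⟨Set.piecewise_eqOn _ _ _, hg.congr (fun _ _ => rfl) fun k hk => ?_⟩, fun k hk => ?_⟩
    · exact (Set.piecewise_eq_of_notMem _ _ _ hk.2).symm
    · by_cases hkX : k ∈ X
      · rw [Set.piecewise_eq_of_mem _ _ _ hkX]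
        exact h1 k hkX
      · rw [Set.piecewise_eq_of_notMem _ _ _ hkX]
        exact hm k ⟨hk, hkX⟩

end existence

/-! ### Multiplying the cycle permutation by a transposition. -/

section retarget

variable {n : ℕ} {p : Preferences n} {U : Set (Fin n)} {a b : Fin n}

/-- The traders in the trading cycles of `favoriteMap p U` interchange the goods `a` and `b` in
their lists. -/
noncomputable def retarget (p : Preferences n) (U : Set (Fin n)) (a b : Fin n) : Preferences n :=
  open scoped Classical in
  fun k => if k ∈ cycleTraders p U then (p k).trans (Equiv.swap a b) else p k

theorem retarget_of_mem {k : Fin n} (hk : k ∈ cycleTraders p U) :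
    retarget p U a b k = (p k).trans (Equiv.swap a b) := if_pos hk

theorem retarget_of_notMem {k : Fin n} (hk : k ∉ cycleTraders p U) :
    retarget p U a b k = p k := if_neg hk

theorem favoriteMap_retarget_of_mem {k : Fin n} (ha : a ∈ U) (hb : b ∈ U)
    (hk : k ∈ cycleTraders p U) :
    favoriteMap (retarget p U a b) U k = Equiv.swap a b (favoriteMap p U k) := by
  rw [favoriteMap, retarget_of_mem hk, favorite_trans_swap k ha hb, favoriteMap]

theorem favoriteMap_retarget_of_notMem {k : Fin n} (hk : k ∉ cycleTraders p U) :
    favoriteMap (retarget p U a b) U k = favoriteMap p U k := by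
  rw [favoriteMap, retarget_of_notMem hk, favoriteMap]

theorem cycleTraders_retarget (hU : U.Nonempty) (ha : a ∈ cycleTraders p U)
    (hb : b ∈ cycleTraders p U) : cycleTraders (retarget p U a b) U = cycleTraders p U := by
  have hsub := cycleTraders_subset p hU
  refine periodicPts_eq_of_bijOn ?_ fun k hk => favoriteMap_retarget_of_notMem hk
  have hswap : Set.BijOn (Equiv.swap a b) (cycleTraders p U) (cycleTraders p U) := by
    have hmaps : Set.MapsTo (Equiv.swap a b) (cycleTraders p U) (cycleTraders p U) := by
      intro z hz
      rw [Equiv.swap_apply_def]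
      split_ifs <;> assumption
    exact ⟨hmaps, (Equiv.injective _).injOn, fun z hz => ⟨_, hmaps hz, by simp⟩⟩
  exact (hswap.comp (bijOn_cycleTraders p U)).congr fun k hk =>
    (favoriteMap_retarget_of_mem (hsub ha) (hsub hb) hk).symm

theorem retarget_retarget (hU : U.Nonempty) (ha : a ∈ cycleTraders p U)
    (hb : b ∈ cycleTraders p U) : retarget (retarget p U a b) U a b = p := by
  funext k
  have hZ := cycleTraders_retarget hU ha hb
  by_cases hk : k ∈ cycleTraders p U
  · rw [retarget_of_mem (hZ.symm ▸ hk), retarget_of_mem hk]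
    ext i
    simp
  · rw [retarget_of_notMem (hZ.symm ▸ hk), retarget_of_notMem hk]

/-- A cycle trader's new favourite stands at the same position as his old one, and the lists of all
other traders of `U` are untouched. -/
theorem stableRanksLE_retarget {m : ℕ} (hU : U.Nonempty) (ha : a ∈ cycleTraders p U)
    (hb : b ∈ cycleTraders p U) :
    StableRanksLE (retarget p U a b) U m ↔ StableRanksLE p U m := by
  have hsub := cycleTraders_subset p hU
  have hbij := bijOn_cycleTraders (retarget p U a b) U
  rw [cycleTraders_retarget hU ha hb] at hbij
  rw [stableRanksLE_iff_of_bijOn hsub hbij,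
    stableRanksLE_iff_of_bijOn hsub (bijOn_cycleTraders p U)]
  refine and_congr (forall₂_congr fun k hk => ?_)
    (stableRanksLE_congr fun k hk => retarget_of_notMem hk.2)
  rw [favoriteMap_retarget_of_mem (hsub ha) (hsub hb) hk, goodRank, retarget_of_mem hk, goodRank]
  simp

end retarget

/-! ### One fixed point on average, and the resulting recursion. -/

section counting

open scoped Classical in
/-- On average, exactly one trader points to himself. -/
theorem sum_card_favoriteMap_eq_self {n : ℕ} (U : Finset (Fin n)) (hU : U.Nonempty) (m : ℕ) :
    ∑ x ∈ U, Finset.card {p : Preferences n | favoriteMap p U x = x ∧ StableRanksLE p U m} =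
      Finset.card {p : Preferences n | StableRanksLE p U m} := by
  have hU' : (U : Set (Fin n)).Nonempty := hU
  -- The pivot depends only on the set of cycle traders, which retargeting preserves, so it can be
  -- read off from the image; the default is never used on such sets.
  let pivot : Set (Fin n) → Fin n := fun Z => if h : Z.Nonempty then h.some else hU.choose
  have hpivot : ∀ p, pivot (cycleTraders p U) ∈ cycleTraders p U := fun p => by
    simp only [pivot, dif_pos (cycleTraders_nonempty p hU')]
    exact Set.Nonempty.some_mem _
  have hfix : ∀ (p : Preferences n) (x : Fin n), favoriteMap p U x = x →
      x ∈ cycleTraders p U := fun p x hx =>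
    Function.mk_mem_periodicPts one_pos (Function.IsFixedPt.isPeriodicPt hx 1)
  rw [← Finset.card_sigma]
  refine Finset.card_bij (fun y _ => retarget y.2 U y.1 (pivot (cycleTraders y.2 U))) ?_ ?_ ?_
  · rintro ⟨x, p⟩ hy
    simp only [Finset.mem_sigma, Finset.mem_filter, Finset.mem_univ, true_and] at hy ⊢
    exact (stableRanksLE_retarget hU' (hfix p x hy.2.1) (hpivot p)).2 hy.2.2
  · rintro ⟨x, p⟩ hy ⟨x', p'⟩ hy' heq
    simp only [Finset.mem_sigma, Finset.mem_filter, Finset.mem_univ, true_and] at hy hy' heq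
    have hx := hfix p x hy.2.1
    have hx' := hfix p' x' hy'.2.1
    have hsub := cycleTraders_subset p hU'
    have hsub' := cycleTraders_subset p' hU'
    have hZ : cycleTraders p U = cycleTraders p' U := by
      rw [← cycleTraders_retarget hU' hx (hpivot p), heq,
        cycleTraders_retarget hU' hx' (hpivot p')]
    have h1 := favoriteMap_retarget_of_mem (hsub hx) (hsub (hpivot p)) hx
    have h2 := favoriteMap_retarget_of_mem (hsub' hx') (hsub' (hpivot p')) hx'
    rw [hy.2.1, Equiv.swap_apply_left, heq] at h1
    rw [hy'.2.1, Equiv.swap_apply_left, ← hZ] at h2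
    -- The fixed trader is recovered as the only cycle trader who points to the pivot after
    -- retargeting.
    have hxx : x = x' := by
      refine (bijOn_cycleTraders (retarget p' U x' (pivot (cycleTraders p' U))) U).injOn ?_ ?_
        (h1.trans (hZ ▸ h2.symm))
      · rw [cycleTraders_retarget hU' hx' (hpivot p'), ← hZ]; exact hx
      · rw [cycleTraders_retarget hU' hx' (hpivot p')]; exact hx'
    subst hxx
    have := congrArg (fun r => retarget r U x (pivot (cycleTraders p U))) heq
    rw [retarget_retarget hU' hx (hpivot p), hZ, retarget_retarget hU' hx' (hpivot p')] at this
    rw [this]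
  · intro p hp
    simp only [Finset.mem_filter, Finset.mem_univ, true_and] at hp
    obtain ⟨x, hx, hfx⟩ := (bijOn_cycleTraders p U).surjOn (hpivot p)
    have hsub := cycleTraders_subset p hU'
    refine ⟨⟨x, retarget p U x (pivot (cycleTraders p U))⟩, ?_, ?_⟩
    · simp only [Finset.mem_sigma, Finset.mem_filter, Finset.mem_univ, true_and]
      refine ⟨hsub hx, ?_, (stableRanksLE_retarget hU' hx (hpivot p)).2 hp⟩
      rw [favoriteMap_retarget_of_mem (hsub hx) (hsub (hpivot p)) hx, hfx,
        Equiv.swap_apply_right]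
    · simp only
      rw [cycleTraders_retarget hU' hx (hpivot p), retarget_retarget hU' hx (hpivot p)]

open scoped Classical in
/-- Resampling one coordinate of a function on which the condition `F q ·` does not depend. -/
theorem card_filter_apply_mul_card {ι α : Type*} [Fintype ι] [DecidableEq ι] [Fintype α]
    (x : ι) (F : α → (ι → α) → Prop) (hF : ∀ q p r, F q (Function.update p x r) ↔ F q p) :
    Finset.card {p : ι → α | F (p x) p} * Fintype.card α =
      ∑ p : ι → α, Finset.card {q : α | F q p} := by
  rw [← Finset.card_univ, ← Finset.card_product, ← Finset.card_sigma]
  -- Exchanging the coordinate `p x` with the fresh sample is its own inverse.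
  refine Finset.card_bij' (fun y _ => ⟨Function.update y.1 x y.2, y.1 x⟩)
    (fun y _ => (Function.update y.1 x y.2, y.1 x)) ?_ ?_ ?_ ?_ <;> simp [hF]

open scoped Classical in
theorem card_filter_apply_and_mul_card {ι α : Type*} [Fintype ι] [DecidableEq ι] [Fintype α]
    (x : ι) (A : α → Prop) (B : (ι → α) → Prop) (hB : ∀ p r, B (Function.update p x r) ↔ B p) :
    Finset.card {p : ι → α | A (p x) ∧ B p} * Fintype.card α =
      Finset.card {q : α | A q} * Finset.card {p : ι → α | B p} := by
  have h := card_filter_apply_mul_card x (fun q p => A q ∧ B p)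
    fun q p r => and_congr_right' (hB p r)
  rw [Finset.card_filter (fun p : ι → α => B p), Finset.mul_sum]
  convert h using 1
  · congr!
  · refine Finset.sum_congr rfl fun p _ => ?_
    by_cases hp : B p <;> simp [hp]

open scoped Classical in
theorem card_stableRanksLE_mul_factorial {n : ℕ} (U : Finset (Fin n)) (hU : U.Nonempty) (m : ℕ) :
    Finset.card {p : Preferences n | StableRanksLE p U m} * n.factorial =
      ∑ x ∈ U, Finset.card {q : Equiv.Perm (Fin n) | favorite q U x = x ∧ q.symm x < m} *
        Finset.card {p : Preferences n | StableRanksLE p (U.erase x : Finset (Fin n)) m} := by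
  rw [← sum_card_favoriteMap_eq_self U hU, Finset.sum_mul]
  refine Finset.sum_congr rfl fun x hx => ?_
  have hcard : n.factorial = Fintype.card (Equiv.Perm (Fin n)) := by
    simp [Fintype.card_perm]
  have hcount := card_filter_apply_and_mul_card x
    (fun q : Equiv.Perm (Fin n) => favorite q U x = x ∧ q.symm x < m)
    (fun p => StableRanksLE p (U.erase x : Finset (Fin n)) m) ?_
  · rw [hcard]
    convert hcount using 2
    · congr 1
      ext p
      simp only [Finset.mem_filter, Finset.mem_univ, true_and, and_assoc]
      refine and_congr_right fun hfix => ?_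
      have hfix' : favoriteMap p U x = x := hfix
      -- A trader pointing to himself is a complete trading cycle and can be removed without the
      -- other cycles.
      have hbij : Set.BijOn (favoriteMap p U) {x} {x} := by
        simp [hfix']
      rw [stableRanksLE_iff_of_bijOn (by simpa using hx) hbij]
      simp [hfix', goodRank]
    · congr!
  · intro p r
    refine stableRanksLE_congr fun k hk => Function.update_of_ne ?_ _ _
    rintro rfl
    simp at hk

end counting

/-! ### Random lists and their initial segments. -/

section permutations

variable {n : ℕ}

theorem card_filter_le_and_mem (O : Finset (Fin n)) {j : ℕ} (hj : j ≤ n)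
    {q : Equiv.Perm (Fin n)} (hq : ∀ i : Fin n, (i : ℕ) < j → q i ∈ O) :
    Finset.card {i : Fin n | j ≤ (i : ℕ) ∧ q i ∈ O} = O.card - j := by
  have hO : Finset.card {i : Fin n | q i ∈ O} = O.card := by
    rw [← Finset.card_map q.toEmbedding]
    congr 1
    ext y
    simp
  have hlt : Finset.card {i : Fin n | (i : ℕ) < j} = j := by
    rw [Fin.card_filter_val_lt]
    omega
  have hsplit := Finset.card_filter_add_card_filter_not
    (s := ({i : Fin n | q i ∈ O} : Finset (Fin n))) (fun i : Fin n => (i : ℕ) < j)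
  rw [Finset.filter_filter, Finset.filter_filter, hO] at hsplit
  have h1 : ({i : Fin n | q i ∈ O ∧ (i : ℕ) < j} : Finset (Fin n)) =
      ({i : Fin n | (i : ℕ) < j} : Finset (Fin n)) := by
    ext i
    simpa using hq i
  have h2 : ({i : Fin n | q i ∈ O ∧ ¬ (i : ℕ) < j} : Finset (Fin n)) =
      ({i : Fin n | j ≤ (i : ℕ) ∧ q i ∈ O} : Finset (Fin n)) := by
    ext i
    simp [and_comm]
  rw [h1, h2, hlt] at hsplit
  omega

/-- Double count pairs of a list with first `j` goods in `O` and a position `i ≥ j` holding a good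
of `O`. Interchanging positions `j` and `i` shows that every `i` contributes equally. -/
theorem card_perm_prefix_succ (O : Finset (Fin n)) {j : ℕ} (hj : j < n) :
    (n - j) * Finset.card
        {q : Equiv.Perm (Fin n) | ∀ i : Fin n, (i : ℕ) < j + 1 → q i ∈ O} =
      Finset.card {q : Equiv.Perm (Fin n) | ∀ i : Fin n, (i : ℕ) < j → q i ∈ O} *
        (O.card - j) := by
  have hcard : Finset.card {i : Fin n | j ≤ (i : ℕ)} = n - j := by
    have := Finset.card_filter_add_card_filter_not (s := (Finset.univ : Finset (Fin n)))
      (fun i : Fin n => (i : ℕ) < j)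
    rw [Fin.card_filter_val_lt, Finset.card_univ, Fintype.card_fin] at this
    simp only [not_lt] at this
    omega
  rw [← hcard, ← smul_eq_mul, ← smul_eq_mul, ← Finset.sum_const, ← Finset.sum_const]
  have hswap : ∀ i ∈ ({i : Fin n | j ≤ (i : ℕ)} : Finset (Fin n)),
      Finset.card {q : Equiv.Perm (Fin n) | ∀ i : Fin n, (i : ℕ) < j + 1 → q i ∈ O} =
      Finset.card {q ∈ ({q : Equiv.Perm (Fin n) | ∀ i : Fin n, (i : ℕ) < j → q i ∈ O} :
        Finset (Equiv.Perm (Fin n))) | q i ∈ O} := by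
    intro i hi
    simp only [Finset.mem_filter, Finset.mem_univ, true_and] at hi
    have hfix : ∀ l : Fin n, (l : ℕ) < j → Equiv.swap ⟨j, hj⟩ i l = l := by
      intro l hl
      refine Equiv.swap_apply_of_ne_of_ne ?_ ?_ <;>
      · rintro rfl
        first
        | exact lt_irrefl _ hl
        | omega
    refine Finset.card_bij' (fun q _ => (Equiv.swap ⟨j, hj⟩ i).trans q)
      (fun q _ => (Equiv.swap ⟨j, hj⟩ i).trans q) ?_ ?_ ?_ ?_
    · intro q hq
      simp only [Finset.mem_filter, Finset.mem_univ, true_and] at hq ⊢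
      refine ⟨fun l hl => ?_, ?_⟩
      · rw [Equiv.trans_apply, hfix l hl]
        exact hq l (by omega)
      · rw [Equiv.trans_apply, Equiv.swap_apply_right]
        exact hq _ (Nat.lt_succ_self j)
    · intro q hq
      simp only [Finset.mem_filter, Finset.mem_univ, true_and] at hq ⊢
      intro l hl
      rcases Nat.lt_succ_iff_lt_or_eq.1 hl with hl | hl
      · rw [Equiv.trans_apply, hfix l hl]
        exact hq.1 l hl
      · have : l = ⟨j, hj⟩ := Fin.ext hl
        rw [this, Equiv.trans_apply, Equiv.swap_apply_left]
        exact hq.2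
    · intro q _
      ext l
      simp
    · intro q _
      ext l
      simp
  rw [Finset.sum_congr rfl hswap]
  simp_rw [Finset.card_filter _ (Finset.filter _ _)]
  rw [Finset.sum_comm]
  refine Finset.sum_congr rfl fun q hq => ?_
  simp only [Finset.mem_filter, Finset.mem_univ, true_and] at hq
  rw [← Finset.card_filter, Finset.filter_filter, card_filter_le_and_mem O hj.le hq]

/-- The number of permutations whose first `j` values lie in `O`. -/
theorem card_perm_prefix_mul_choose (O : Finset (Fin n)) {j : ℕ} (hj : j ≤ n) :
    Finset.card {q : Equiv.Perm (Fin n) | ∀ i : Fin n, (i : ℕ) < j → q i ∈ O} * n.choose j =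
      n.factorial * O.card.choose j := by
  induction j with
  | zero => simp [Finset.card_univ, Fintype.card_perm]
  | succ j ih =>
    have hstep := card_perm_prefix_succ O hj
    have ih := ih (by omega)
    refine Nat.eq_of_mul_eq_mul_right (Nat.succ_pos j) ?_
    rw [mul_assoc, mul_assoc, Nat.choose_succ_right_eq, Nat.choose_succ_right_eq]
    calc _ = n.choose j * ((n - j) * Finset.card
          {q : Equiv.Perm (Fin n) | ∀ i : Fin n, (i : ℕ) < j + 1 → q i ∈ O}) := by ring
      _ = (Finset.card {q : Equiv.Perm (Fin n) | ∀ i : Fin n, (i : ℕ) < j → q i ∈ O} *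
          n.choose j) * (O.card - j) := by rw [hstep]; ring
      _ = _ := by rw [ih]; ring

open scoped Classical in
-- Either the favourite good of `U` is among the first `m`, and the lists are sorted by which good
-- it is, or the first `m` goods all miss `U`.
theorem sum_card_favorite_eq_add (U : Finset (Fin n)) (hU : U.Nonempty) (m : ℕ) :
    ∑ x ∈ U, Finset.card {q : Equiv.Perm (Fin n) | favorite q U x = x ∧ q.symm x < m} +
      Finset.card {q : Equiv.Perm (Fin n) | ∀ i : Fin n, (i : ℕ) < m → q i ∈ Uᶜ} =
      n.factorial := by
  obtain ⟨d, hd⟩ := hU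
  have hne : (U : Set (Fin n)).Nonempty := ⟨d, hd⟩
  have hfav : ∀ (q : Equiv.Perm (Fin n)) (x : Fin n), favorite q U x = favorite q U d :=
    fun q x => eq_favorite d (favorite_mem x hne) fun z hz => symm_favorite_le x hz
  have hcard : n.factorial = Finset.card (Finset.univ : Finset (Equiv.Perm (Fin n))) := by
    simp [Finset.card_univ, Fintype.card_perm]
  rw [hcard, ← Finset.card_filter_add_card_filter_not (s := Finset.univ)
    (fun q : Equiv.Perm (Fin n) => (q.symm (favorite q U d) : ℕ) < m)]
  congr 1
  · rw [Finset.card_eq_sum_card_fiberwise (f := fun q => favorite q U d) (t := U)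
      fun q _ => favorite_mem d hne]
    refine Finset.sum_congr rfl fun x _ => ?_
    congr 1
    ext q
    simp only [Finset.mem_filter, Finset.mem_univ, true_and, hfav q x]
    constructor
    · rintro ⟨h1, h2⟩
      exact ⟨h1.symm ▸ h2, h1⟩
    · rintro ⟨h1, h2⟩
      exact ⟨h2, by rwa [h2] at h1⟩
  · congr 1
    ext q
    simp only [Finset.mem_filter, Finset.mem_univ, true_and, Finset.mem_compl, not_lt]
    constructor
    · intro h
      by_contra! hlt
      exact h _ hlt (by simpa using favorite_mem (q := q) d hne)
    · intro h i hi hqi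
      have := symm_favorite_le (q := q) d (U := U) hqi
      rw [Equiv.symm_apply_apply] at this
      exact absurd (Fin.le_def.1 this) (by omega)

end permutations

/-! ### The law of the largest stable rank. -/

section probability

variable {n : ℕ}

open scoped Classical in
theorem preferenceMeasure_real_eq (S : Set (Preferences n)) :
    (preferenceMeasure n).real S =
      (Finset.card {p : Preferences n | p ∈ S} : ℝ) / (n.factorial : ℝ) ^ n := by
  have h : preferenceMeasure n = uniformOn Set.univ := by
    rw [preferenceMeasure, ← uniformOn_pi, Set.pi_univ]
  rw [h, Measure.real, uniformOn_univ]
  have hS : Measure.count S = (Finset.card {p : Preferences n | p ∈ S} : ENNReal) := by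
    rw [← Measure.count_apply_finset]
    simp
  rw [hS, ENNReal.toReal_div]
  simp [Fintype.card_perm]

open scoped Classical in
theorem card_stableRanksLE (U : Finset (Fin n)) {m : ℕ} (hm : m ≤ n) :
    (Finset.card {p : Preferences n | StableRanksLE p U m} : ℝ) =
      (n.factorial : ℝ) ^ n *
        ∏ k ∈ Finset.Ico (n - U.card) n, (1 - (k.choose m : ℝ) / (n.choose m : ℝ)) := by
  induction hu : U.card generalizing U with
  | zero =>
    rw [Finset.card_eq_zero] at hu
    subst hu
    simp [stableRanksLE_empty, Fintype.card_perm]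
  | succ u ih =>
    have hU : U.Nonempty := Finset.card_pos.1 (by omega)
    have hun : u + 1 ≤ n := by
      rw [← hu]
      simpa using Finset.card_le_univ U
    have hfac : (n.factorial : ℝ) ≠ 0 := by exact_mod_cast n.factorial_ne_zero
    have hch : (n.choose m : ℝ) ≠ 0 := by exact_mod_cast (Nat.choose_pos hm).ne'
    -- By induction the count for `U.erase x` does not depend on `x`, so it factors out of the
    -- recursion; the remaining sum supplies the new factor at `k = n - (u + 1)`.
    have h1 : (Finset.card {p : Preferences n | StableRanksLE p U m} : ℝ) * n.factorial =
        (∑ x ∈ U, Finset.card {q : Equiv.Perm (Fin n) | favorite q U x = x ∧ q.symm x < m} : ℕ) *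
          ((n.factorial : ℝ) ^ n *
            ∏ k ∈ Finset.Ico (n - u) n, (1 - (k.choose m : ℝ) / (n.choose m : ℝ))) := by
      rw [← Nat.cast_mul, card_stableRanksLE_mul_factorial U hU m, Nat.cast_sum, Nat.cast_sum,
        Finset.sum_mul]
      refine Finset.sum_congr rfl fun x hx => ?_
      rw [Nat.cast_mul, ih (U.erase x) (by rw [Finset.card_erase_of_mem hx, hu]; rfl)]
    have h2 := sum_card_favorite_eq_add U hU m
    have h3 := card_perm_prefix_mul_choose Uᶜ hm
    rw [Finset.card_compl, hu, Fintype.card_fin] at h3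
    have h2' := congrArg (Nat.cast : ℕ → ℝ) h2
    have h3' := congrArg (Nat.cast : ℕ → ℝ) h3
    rw [Nat.cast_add] at h2'
    rw [Nat.cast_mul, Nat.cast_mul] at h3'
    have h4 : ((∑ x ∈ U, Finset.card
        {q : Equiv.Perm (Fin n) | favorite q U x = x ∧ q.symm x < m} : ℕ) : ℝ) =
        n.factorial * (1 - ((n - (u + 1)).choose m : ℝ) / (n.choose m : ℝ)) := by
      rw [mul_sub, ← mul_div_assoc, ← h3', mul_div_cancel_right₀ _ hch, mul_one]
      convert eq_sub_of_add_eq h2'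
    rw [h4] at h1
    refine mul_right_cancel₀ hfac (h1.trans ?_)
    have hIco : Finset.Ico (n - (u + 1)) n = insert (n - (u + 1)) (Finset.Ico (n - u) n) := by
      ext a
      simp only [Finset.mem_Ico, Finset.mem_insert]
      omega
    rw [hIco, Finset.prod_insert (by simp; omega)]
    ring

/-- The distribution function of the largest rank in the stable allocation. -/
theorem preferenceMeasure_real_stableRank_le {m : ℕ} (hm : m ≤ n) :
    (preferenceMeasure n).real {p | ∀ k, stableRank p k ≤ m} =
      ∏ k ∈ Finset.range n, (1 - (k.choose m : ℝ) / (n.choose m : ℝ)) := by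
  classical
  have hfac : (n.factorial : ℝ) ^ n ≠ 0 := pow_ne_zero _ (by exact_mod_cast n.factorial_ne_zero)
  have h := card_stableRanksLE (Finset.univ : Finset (Fin n)) hm
  rw [preferenceMeasure_real_eq, div_eq_iff hfac, mul_comm]
  simp only [Finset.coe_univ, stableRanksLE_univ_iff, Finset.card_univ, Fintype.card_fin,
    Nat.sub_self, Finset.range_eq_Ico] at h ⊢
  convert h using 3
  ext p
  simp

end probability

/-! ### Uniform hashing. -/

section hashing

variable {n : ℕ}

theorem hashPosition_spec (p : Preferences n) (k : Fin n) :
    (∀ l < k, p l (hashPosition p l) ≠ p k (hashPosition p k)) ∧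
      ∀ i, (∀ l < k, p l (hashPosition p l) ≠ p k i) → hashPosition p k ≤ i := by
  have hdef := hashPosition.eq_1 p k
  constructor
  · have hmem := Finset.min'_mem _
      (exists_free_position k (p k) (fun j => p j.1 (hashPosition p j.1)))
    rw [← hdef, Finset.mem_filter] at hmem
    exact fun l hl => hmem.2 ⟨l, hl⟩
  · intro i hi
    rw [hdef]
    exact Finset.min'_le _ _ (Finset.mem_filter.2 ⟨Finset.mem_univ _, fun (l : {l // l < k}) => hi l.1 l.2⟩)

theorem hashPosition_congr {p p' : Preferences n} {k : Fin n} (h : ∀ l ≤ k, p l = p' l) :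
    hashPosition p k = hashPosition p' k := by
  induction k using WellFoundedLT.induction with
  | ind k ih =>
    have heq : ∀ l < k, p l (hashPosition p l) = p' l (hashPosition p' l) := fun l hl => by
      rw [ih l hl fun a ha => h a (ha.trans hl.le), h l hl.le]
    obtain ⟨h1, h2⟩ := hashPosition_spec p k
    obtain ⟨h1', h2'⟩ := hashPosition_spec p' k
    refine le_antisymm (h2 _ fun l hl => ?_) (h2' _ fun l hl => ?_)
    · rw [heq l hl, h k le_rfl]
      exact h1' l hl
    · rw [← heq l hl, ← h k le_rfl]
      exact h1 l hl

/-- The goods that trader `k` finds taken. -/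
def takenGoods (p : Preferences n) (k : Fin n) : Finset (Fin n) :=
  (Finset.Iio k).image fun l => p l (hashPosition p l)

theorem card_takenGoods (p : Preferences n) (k : Fin n) : (takenGoods p k).card = k := by
  rw [takenGoods, Finset.card_image_of_injective, Fin.card_Iio]
  intro a b hab
  rcases lt_trichotomy a b with h | h | h
  · exact absurd hab ((hashPosition_spec p b).1 a h)
  · exact h
  · exact absurd hab.symm ((hashPosition_spec p a).1 b h)

/-- This is the independence that allows the list of `k` to be resampled with the taken goods held
fixed. -/
theorem takenGoods_update (p : Preferences n) (k : Fin n) (r : Equiv.Perm (Fin n)) :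
    takenGoods (Function.update p k r) k = takenGoods p k := by
  refine Finset.image_congr fun l hl => ?_
  have hl : l < k := by simpa using hl
  have hupd : ∀ a ≤ l, Function.update p k r a = p a := fun a ha =>
    Function.update_of_ne (ha.trans_lt hl).ne _ _
  rw [hashPosition_congr hupd, hupd l le_rfl]

theorem lt_hashRank_iff (p : Preferences n) (k : Fin n) (j : ℕ) :
    j < hashRank p k ↔ ∀ i : Fin n, (i : ℕ) < j → p k i ∈ takenGoods p k := by
  obtain ⟨h1, h2⟩ := hashPosition_spec p k
  have hmem : ∀ i, p k i ∈ takenGoods p k ↔ ∃ l < k, p l (hashPosition p l) = p k i := by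
    simp [takenGoods]
  rw [hashRank, Nat.lt_succ_iff]
  constructor
  · intro h i hi
    by_contra hno
    rw [hmem] at hno
    push Not at hno
    have := Fin.le_def.1 (h2 i hno)
    omega
  · intro h
    by_contra! hlt
    obtain ⟨l, hl, heq⟩ := (hmem _).1 (h _ hlt)
    exact h1 l hl heq

theorem hashTail_eq (n : ℕ) (k : Fin n) {j : ℕ} (hj : j ≤ n) :
    hashTail n k j = ((k : ℕ).choose j : ℝ) / (n.choose j : ℝ) := by
  classical
  have hfac : (n.factorial : ℝ) ≠ 0 := by exact_mod_cast n.factorial_ne_zero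
  have hch : (n.choose j : ℝ) ≠ 0 := by exact_mod_cast (Nat.choose_pos hj).ne'
  have hcount := card_filter_apply_mul_card k
    (fun (q : Equiv.Perm (Fin n)) (p : Preferences n) =>
      ∀ i : Fin n, (i : ℕ) < j → q i ∈ takenGoods p k)
    (fun q p r => by rw [takenGoods_update])
  have hq : ∀ p : Preferences n, (Finset.card
      {q : Equiv.Perm (Fin n) | ∀ i : Fin n, (i : ℕ) < j → q i ∈ takenGoods p k} : ℝ) =
      n.factorial * ((k : ℕ).choose j : ℝ) / (n.choose j : ℝ) := fun p => by
    rw [eq_div_iff hch]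
    have := card_perm_prefix_mul_choose (takenGoods p k) hj
    rw [card_takenGoods] at this
    exact_mod_cast this
  have hcount' := congrArg (Nat.cast : ℕ → ℝ) hcount
  rw [Nat.cast_mul, Nat.cast_sum] at hcount'
  rw [hashTail, preferenceMeasure_real_eq]
  simp only [Set.mem_ofPred_eq, lt_hashRank_iff]
  have hsum : (Finset.card {p : Preferences n |
      ∀ i : Fin n, (i : ℕ) < j → p k i ∈ takenGoods p k} : ℝ) * n.factorial =
      (n.factorial : ℝ) ^ n * (n.factorial * ((k : ℕ).choose j : ℝ) / (n.choose j : ℝ)) := by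
    calc _ = ∑ p : Preferences n, (Finset.card {q : Equiv.Perm (Fin n) |
            ∀ i : Fin n, (i : ℕ) < j → q i ∈ takenGoods p k} : ℝ) := by
          rw [Fintype.card_perm, Fintype.card_fin] at hcount'
          convert hcount' <;> rfl
      _ = ∑ p : Preferences n, n.factorial * ((k : ℕ).choose j : ℝ) / (n.choose j : ℝ) :=
          Finset.sum_congr rfl fun p _ => by
            rw [← hq p]
      _ = _ := by simp [Fintype.card_perm]
  rw [div_eq_iff (pow_ne_zero _ hfac)]
  refine mul_right_cancel₀ hfac (Eq.trans ?_ (hsum.trans ?_))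
  · congr!
  · ring

theorem preferenceMeasure_real_hashRank_last_eq {n : ℕ} (hn : 1 ≤ n) {r : ℕ}
    (hr : r ∈ Finset.Icc 1 n) :
    (preferenceMeasure n).real {p | hashRank p ⟨n - 1, Nat.sub_one_lt_of_lt hn⟩ = r} =
      1 / (n : ℝ) := by
  obtain ⟨n, rfl⟩ : ∃ a, n = a + 1 := ⟨n - 1, by omega⟩
  obtain ⟨r, rfl⟩ : ∃ a, r = a + 1 := ⟨r - 1, by have := (Finset.mem_Icc.1 hr).1; omega⟩
  have hrn := (Finset.mem_Icc.1 hr).2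
  set k : Fin (n + 1) := ⟨n + 1 - 1, Nat.sub_one_lt_of_lt hn⟩ with hk
  -- For the last trader the tail is linear in `j`, so its successive differences are constant.
  have htail : ∀ j, j ≤ n + 1 → hashTail (n + 1) k j = ((n + 1 : ℝ) - j) / (n + 1) := by
    intro j hj
    rw [hashTail_eq _ _ hj]
    have hpos : ((n + 1).choose j : ℝ) ≠ 0 := by exact_mod_cast (Nat.choose_pos hj).ne'
    rw [div_eq_div_iff hpos (by positivity)]
    have := Nat.choose_mul_succ_eq n j
    have hcast := congrArg (Nat.cast : ℕ → ℝ) this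
    rw [Nat.cast_mul, Nat.cast_mul, Nat.cast_sub hj] at hcast
    push_cast at hcast
    simp only [hk, Nat.add_sub_cancel]
    rw [hcast]
    ring
  have hset : {p | hashRank p k = r + 1} =
      {p : Preferences (n + 1) | r < hashRank p k} \ {p | r + 1 < hashRank p k} := by
    ext p
    simp only [Set.mem_ofPred_eq, Set.mem_sdiff]
    omega
  rw [hset, measureReal_sdiff _ (Set.toFinite _).measurableSet]
  · change hashTail (n + 1) k r - hashTail (n + 1) k (r + 1) = _
    rw [htail _ (by omega), htail _ hrn]
    push_cast
    ring
  · intro p hp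
    simp only [Set.mem_ofPred_eq] at hp ⊢
    omega

end hashing

/-! ### Convergence and numerical value of the infinite product. -/

section eulerProduct

theorem multipliable_one_sub_half_pow : Multipliable (fun j : ℕ => 1 - (1 / 2 : ℝ) ^ (j + 1)) := by
  have hs : Summable fun j : ℕ => -(1 / 2 : ℝ) ^ (j + 1) :=
    ((summable_nat_add_iff 1).2 summable_geometric_two).neg
  simpa only [← sub_eq_add_neg] using Real.multipliable_one_add_of_summable hs

theorem one_sub_half_pow_mem_Icc (j : ℕ) : 1 - (1 / 2 : ℝ) ^ (j + 1) ∈ Set.Icc (0 : ℝ) 1 := by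
  have h1 : (1 / 2 : ℝ) ^ (j + 1) ≤ 1 := pow_le_one₀ (by norm_num) (by norm_num)
  have h2 : (0 : ℝ) < (1 / 2 : ℝ) ^ (j + 1) := by positivity
  exact ⟨by linarith, by linarith⟩

theorem prod_one_sub_half_pow_nonneg (N : ℕ) :
    0 ≤ ∏ j ∈ Finset.range N, (1 - (1 / 2 : ℝ) ^ (j + 1)) :=
  Finset.prod_nonneg fun j _ => (one_sub_half_pow_mem_Icc j).1

theorem tprod_one_sub_half_pow_le (N : ℕ) :
    ∏' j : ℕ, (1 - (1 / 2 : ℝ) ^ (j + 1)) ≤ ∏ j ∈ Finset.range N, (1 - (1 / 2 : ℝ) ^ (j + 1)) := by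
  refine le_of_tendsto multipliable_one_sub_half_pow.tendsto_prod_tprod_nat ?_
  filter_upwards [eventually_ge_atTop N] with M hM
  induction M, hM using Nat.le_induction with
  | base => exact le_rfl
  | succ M _ ih =>
    rw [Finset.prod_range_succ]
    exact (mul_le_of_le_one_right (prod_one_sub_half_pow_nonneg M)
      (one_sub_half_pow_mem_Icc M).2).trans ih

theorem le_tprod_one_sub_half_pow (N : ℕ) :
    (∏ j ∈ Finset.range N, (1 - (1 / 2 : ℝ) ^ (j + 1))) * (1 - (1 / 2 : ℝ) ^ N) ≤
      ∏' j : ℕ, (1 - (1 / 2 : ℝ) ^ (j + 1)) := by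
  have hP := prod_one_sub_half_pow_nonneg N
  refine ge_of_tendsto multipliable_one_sub_half_pow.tendsto_prod_tprod_nat ?_
  filter_upwards [eventually_ge_atTop N] with M hM
  -- The factors from `N` to `M - 1` multiply to at least one minus the sum of their defects, which
  -- is `2⁻ᴺ - 2⁻ᴹ`; keeping the term `2⁻ᴹ` makes the induction close.
  suffices h : (∏ j ∈ Finset.range N, (1 - (1 / 2 : ℝ) ^ (j + 1))) *
      (1 - (1 / 2 : ℝ) ^ N + (1 / 2 : ℝ) ^ M) ≤
      ∏ j ∈ Finset.range M, (1 - (1 / 2 : ℝ) ^ (j + 1)) by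
    refine (mul_le_mul_of_nonneg_left ?_ hP).trans h
    have : (0 : ℝ) < (1 / 2 : ℝ) ^ M := by positivity
    linarith
  induction M, hM using Nat.le_induction with
  | base => simp
  | succ M hM ih =>
    rw [Finset.prod_range_succ]
    refine le_trans ?_ (mul_le_mul_of_nonneg_right ih (one_sub_half_pow_mem_Icc M).1)
    rw [mul_assoc]
    refine mul_le_mul_of_nonneg_left ?_ hP
    have h1 : (1 / 2 : ℝ) ^ M ≤ (1 / 2 : ℝ) ^ N :=
      pow_le_pow_of_le_one (by norm_num) (by norm_num) hM
    have h2 : (0 : ℝ) < (1 / 2 : ℝ) ^ M := by positivity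
    rw [pow_succ]
    nlinarith [mul_nonneg h2.le (sub_nonneg.2 h1)]

theorem abs_tprod_one_sub_half_pow_sub_lt :
    |(∏' j : ℕ, (1 - (1 / 2 : ℝ) ^ (j + 1))) - 0.288788| < 5 / 10 ^ 7 := by
  -- With 22 factors the two bounds differ by less than `2⁻²²` times 0.29, which is below `10⁻⁷`.
  have h1 := tprod_one_sub_half_pow_le 22
  have h2 := le_tprod_one_sub_half_pow 22
  have h3 : ∏ j ∈ Finset.range 22, (1 - (1 / 2 : ℝ) ^ (j + 1)) < 0.288788 + 5 / 10 ^ 7 := by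
    norm_num [Finset.prod_range_succ]
  have h4 : 0.288788 - 5 / 10 ^ 7 <
      (∏ j ∈ Finset.range 22, (1 - (1 / 2 : ℝ) ^ (j + 1))) * (1 - (1 / 2 : ℝ) ^ 22) := by
    norm_num [Finset.prod_range_succ]
  rw [abs_lt]
  constructor <;> linarith

end eulerProduct

/-! ### The limit of the product, and the bound `1/2`. -/

section limit

theorem choose_sub_succ_div {n m j : ℕ} (hj : j < n) :
    ((n - (j + 1)).choose m : ℝ) / (n.choose m : ℝ) =
      ((n - j).choose m : ℝ) / (n.choose m : ℝ) * (((n - j - m : ℕ) : ℝ) / ((n - j : ℕ) : ℝ)) := by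
  obtain ⟨N, hN⟩ : ∃ N, n - j = N + 1 := ⟨n - j - 1, by omega⟩
  have h := Nat.choose_mul_succ_eq N m
  have h' := congrArg (Nat.cast : ℕ → ℝ) h
  rw [Nat.cast_mul, Nat.cast_mul] at h'
  rw [← Nat.sub_sub, hN, Nat.add_sub_cancel, div_mul_div_comm, ← h', mul_div_mul_right]
  exact_mod_cast N.succ_ne_zero

theorem choose_sub_div_le {n j : ℕ} (hn : 2 ≤ n) (hj : j ≤ n) :
    ((n - j).choose (n / 2) : ℝ) / (n.choose (n / 2) : ℝ) ≤ (2 / 3) ^ j := by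
  induction j with
  | zero => simpa using div_self_le_one _
  | succ j ih =>
    rw [choose_sub_succ_div hj, pow_succ]
    refine mul_le_mul (ih (by omega)) ?_ (by positivity) (by positivity)
    have hpos : (0 : ℝ) < ((n - j : ℕ) : ℝ) := by exact_mod_cast Nat.sub_pos_of_lt hj
    rw [div_le_div_iff₀ hpos (by norm_num)]
    -- The constant `2/3` is attained at `n = 3`, `j = 0`.
    exact_mod_cast (by omega : (n - j - n / 2) * 3 ≤ 2 * (n - j))

theorem tendsto_sub_half_div (j : ℕ) :
    Tendsto (fun n : ℕ => ((n - j - n / 2 : ℕ) : ℝ) / ((n - j : ℕ) : ℝ)) atTop (𝓝 (1 / 2)) := by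
  have hlim : Tendsto (fun n : ℕ => ((j : ℝ) + 1) / ((n - j : ℕ) : ℝ)) atTop (𝓝 0) :=
    (tendsto_const_div_atTop_nhds_zero_nat ((j : ℝ) + 1)).comp (tendsto_sub_atTop_nat j)
  rw [tendsto_iff_dist_tendsto_zero]
  refine squeeze_zero' (Eventually.of_forall fun _ => dist_nonneg) ?_ hlim
  -- Beyond `2 * j` no subtraction truncates, and twice the numerator differs from the denominator
  -- only by the parity of `n` minus `j`.
  filter_upwards [eventually_gt_atTop (2 * j)] with n hn
  have hpos : (0 : ℝ) < ((n - j : ℕ) : ℝ) := by exact_mod_cast (by omega : 0 < n - j)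
  have h1 : 2 * ((n - j - n / 2 : ℕ) : ℝ) ≤ ((n - j : ℕ) : ℝ) + (j + 1) := by
    exact_mod_cast (by omega : 2 * (n - j - n / 2) ≤ n - j + (j + 1))
  have h2 : ((n - j : ℕ) : ℝ) ≤ 2 * ((n - j - n / 2 : ℕ) : ℝ) + (j + 1) := by
    exact_mod_cast (by omega : n - j ≤ 2 * (n - j - n / 2) + (j + 1))
  have hj : (0 : ℝ) ≤ j := j.cast_nonneg
  rw [Real.dist_eq, div_sub_div _ _ hpos.ne' two_ne_zero, abs_div, abs_of_pos (by positivity :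
    (0 : ℝ) < ((n - j : ℕ) : ℝ) * 2), div_le_div_iff₀ (by positivity) hpos]
  have h3 : |((n - j - n / 2 : ℕ) : ℝ) * 2 - ((n - j : ℕ) : ℝ) * 1| ≤ ((j : ℝ) + 1) * 2 := by
    rw [abs_le]
    constructor <;> linarith
  nlinarith [mul_le_mul_of_nonneg_right h3 hpos.le]

theorem tendsto_choose_sub_div (j : ℕ) :
    Tendsto (fun n : ℕ => ((n - j).choose (n / 2) : ℝ) / (n.choose (n / 2) : ℝ)) atTop
      (𝓝 ((1 / 2) ^ j)) := by
  induction j with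
  | zero =>
    refine tendsto_const_nhds.congr fun n => ?_
    have : (n.choose (n / 2) : ℝ) ≠ 0 := by
      exact_mod_cast (Nat.choose_pos (Nat.div_le_self n 2)).ne'
    simp [this]
  | succ j ih =>
    rw [pow_succ]
    refine (ih.mul (tendsto_sub_half_div j)).congr' ?_
    filter_upwards [eventually_gt_atTop j] with n hn
    exact (choose_sub_succ_div hn).symm

theorem tendsto_prod_one_sub_choose_div :
    Tendsto (fun n : ℕ =>
        ∏ k ∈ Finset.range n, (1 - (k.choose (n / 2) : ℝ) / (n.choose (n / 2) : ℝ))) atTop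
      (𝓝 (∏' j : ℕ, (1 - (1 / 2 : ℝ) ^ (j + 1)))) := by
  have hlim := tendsto_tprod_one_add_of_dominated_convergence (𝓕 := atTop)
    (f := fun n j : ℕ => if j < n then
      -(((n - (j + 1)).choose (n / 2) : ℝ) / (n.choose (n / 2) : ℝ)) else 0)
    (g := fun j : ℕ => -(1 / 2 : ℝ) ^ (j + 1)) (bound := fun j : ℕ => (2 / 3 : ℝ) ^ (j + 1))
    ((summable_nat_add_iff 1).2 (summable_geometric_of_lt_one (by norm_num) (by norm_num)))
    (fun j => ((tendsto_choose_sub_div (j + 1)).neg).congr' ?_) ?_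
  · simp only [← sub_eq_add_neg] at hlim
    refine hlim.congr fun n => ?_
    -- The padded infinite product is finite; reflecting the index puts `k = n - (j + 1)`, so that
    -- the factors near `k = n` govern the limit.
    rw [tprod_eq_prod (s := Finset.range n) fun j hj => by
      rw [if_neg (by simpa using hj), add_zero], ← Finset.prod_range_reflect]
    refine Finset.prod_congr rfl fun j hj => ?_
    have hj := Finset.mem_range.1 hj
    rw [if_pos (by omega), ← sub_eq_add_neg, show n - (n - 1 - j + 1) = j by omega]
  · filter_upwards [eventually_gt_atTop j] with n hn
    rw [if_pos hn]
  · filter_upwards [eventually_ge_atTop 2] with n hn j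
    split_ifs with hj
    · rw [norm_neg, Real.norm_of_nonneg (by positivity)]
      exact choose_sub_div_le hn hj
    · rw [norm_zero]
      positivity

theorem setOf_sup_stableRank_le_half (n : ℕ) :
    {p : Preferences n | ((Finset.univ.sup (stableRank p) : ℕ) : ℝ) ≤ (n : ℝ) / 2} =
      {p | ∀ k, stableRank p k ≤ n / 2} := by
  ext p
  have h : ((Finset.univ.sup (stableRank p) : ℕ) : ℝ) ≤ (n : ℝ) / 2 ↔
      Finset.univ.sup (stableRank p) ≤ n / 2 := by
    rw [le_div_iff₀ two_pos, Nat.le_div_iff_mul_le two_pos]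
    exact_mod_cast Iff.rfl
  exact h.trans (by simp)

theorem half_le_preferenceMeasure_real_exists {n : ℕ} (hn : 1 ≤ n) :
    1 / 2 ≤ (preferenceMeasure n).real {p | ∃ k : Fin n, (n : ℝ) / 2 ≤ (stableRank p k : ℝ)} := by
  -- A rank is below `n / 2` in the reals exactly when it is at most the floor of `(n - 1) / 2`.
  have hset : {p : Preferences n | ∃ k : Fin n, (n : ℝ) / 2 ≤ (stableRank p k : ℝ)} =
      {p | ∀ k, stableRank p k ≤ (n - 1) / 2}ᶜ := by
    ext p
    simp only [Set.mem_ofPred_eq, Set.mem_compl_iff, not_forall]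
    refine exists_congr fun k => ?_
    rw [div_le_iff₀ two_pos]
    have : (n : ℝ) ≤ stableRank p k * 2 ↔ n ≤ stableRank p k * 2 := by exact_mod_cast Iff.rfl
    rw [this]
    omega
  rw [hset, measureReal_compl (Set.toFinite _).measurableSet, probReal_univ,
    preferenceMeasure_real_stableRank_le (by omega)]
  obtain ⟨n, rfl⟩ : ∃ a, n = a + 1 := ⟨n - 1, by omega⟩
  rw [Nat.add_sub_cancel, Finset.prod_range_succ]
  have hpos : (0 : ℝ) < ((n + 1).choose (n / 2) : ℝ) := by
    exact_mod_cast Nat.choose_pos (by omega)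
  have hq : ∀ k ≤ n + 1, (k.choose (n / 2) : ℝ) / ((n + 1).choose (n / 2) : ℝ) ≤ 1 := fun k hk =>
    (div_le_one hpos).2 (by exact_mod_cast Nat.choose_le_choose _ hk)
  have hprod : ∏ k ∈ Finset.range n,
      (1 - (k.choose (n / 2) : ℝ) / ((n + 1).choose (n / 2) : ℝ)) ≤ 1 :=
    Finset.prod_le_one (fun k hk => sub_nonneg.2 (hq k (by simp at hk; omega)))
      fun k _ => sub_le_self _ (by positivity)
  -- With `n + 1` traders this quotient is `(n + 1 - n / 2) / (n + 1)`, with `n / 2` rounded down,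
  -- so the last factor alone is at most `1/2`.
  have hlast : 1 / 2 ≤ (n.choose (n / 2) : ℝ) / ((n + 1).choose (n / 2) : ℝ) := by
    rw [div_le_div_iff₀ two_pos hpos, one_mul]
    have h := Nat.choose_mul_succ_eq n (n / 2)
    have h2 : (n + 1).choose (n / 2) * (n + 1) ≤ n.choose (n / 2) * 2 * (n + 1) := by
      calc _ ≤ (n + 1).choose (n / 2) * ((n + 1 - n / 2) * 2) :=
            Nat.mul_le_mul_left _ (by omega)
        _ = _ := by rw [← mul_assoc, ← h]; ring
    exact_mod_cast Nat.le_of_mul_le_mul_right h2 n.succ_pos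
  have := mul_le_mul hprod (sub_le_sub_left hlast 1) (sub_nonneg.2 (hq n (by omega))) zero_le_one
  linarith

end limit

theorem mainTheorem6 :
    -- every preference sequence has exactly one stable allocation
    (∀ (n : ℕ) (p : Preferences n), ∃! g : Equiv.Perm (Fin n), IsStableAllocation p g) ∧
    -- the last rank in uniform hashing is uniform on `{1, …, n}`
    (∀ (n : ℕ) (hn : 1 ≤ n), ∀ r ∈ Finset.Icc 1 n,
      (preferenceMeasure n).real {p | hashRank p ⟨n - 1, Nat.sub_one_lt_of_lt hn⟩ = r}
        = 1 / (n : ℝ)) ∧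
    -- with probability at least `1/2` some trader has rank at least `n/2`
    (∀ n : ℕ, 1 ≤ n →
      1 / 2 ≤ (preferenceMeasure n).real {p | ∃ k : Fin n, (n : ℝ) / 2 ≤ (stableRank p k : ℝ)}) ∧
    -- the numbers `q_{kj}` in closed form (`k : Fin n` is zero-based)
    (∀ (n : ℕ) (k : Fin n) (j : ℕ), j ≤ n →
      hashTail n k j = ((k : ℕ).choose j : ℝ) / (n.choose j : ℝ)) ∧
    -- the exact distribution of the maximum rank at `n/2`
    (∀ n : ℕ, 1 ≤ n →
      (preferenceMeasure n).real
          {p | ((Finset.univ.sup (stableRank p) : ℕ) : ℝ) ≤ (n : ℝ) / 2}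
        = ∏ k : Fin n, (1 - hashTail n k (n / 2))) ∧
    -- its limit, and the numerical value of the limit
    Multipliable (fun j : ℕ => 1 - (1 / 2 : ℝ) ^ (j + 1)) ∧
    Tendsto
      (fun n : ℕ => (preferenceMeasure n).real
          {p | ((Finset.univ.sup (stableRank p) : ℕ) : ℝ) ≤ (n : ℝ) / 2})
      atTop (𝓝 (∏' j : ℕ, (1 - (1 / 2 : ℝ) ^ (j + 1)))) ∧
    |(∏' j : ℕ, (1 - (1 / 2 : ℝ) ^ (j + 1))) - 0.288788| < 5 / 10 ^ 7 := by
  have hdist : ∀ n : ℕ, (preferenceMeasure n).real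
      {p | ((Finset.univ.sup (stableRank p) : ℕ) : ℝ) ≤ (n : ℝ) / 2} =
      ∏ k ∈ Finset.range n, (1 - (k.choose (n / 2) : ℝ) / (n.choose (n / 2) : ℝ)) := fun n => by
    rw [setOf_sup_stableRank_le_half, preferenceMeasure_real_stableRank_le (Nat.div_le_self n 2)]
  refine ⟨fun n p => existsUnique_isStableAllocation p,
    fun n hn r hr => preferenceMeasure_real_hashRank_last_eq hn hr,
    fun n hn => half_le_preferenceMeasure_real_exists hn,
    fun n k j hj => hashTail_eq n k hj, fun n _ => ?_, multipliable_one_sub_half_pow,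
    tendsto_prod_one_sub_choose_div.congr fun n => (hdist n).symm,
    abs_tprod_one_sub_half_pow_sub_lt⟩
  rw [hdist, Finset.prod_range]
  exact Finset.prod_congr rfl fun k _ => by rw [hashTail_eq n k (Nat.div_le_self n 2)]
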